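/- Let $\mathbb{F}$ be a field of arbitrary characteristic and let $\Delta$ be an $\mathbb{F}$-homology $(d-1)$-sphere with vertex set $\{1,\dots,m\}$; that is, $\Delta$ is a finite simplicial complex such that for every face $\sigma\in\Delta$ (including $\sigma=\emptyset$) the link of $\sigma$ has the same homology with coefficients in $\mathbb{F}$ as a sphere of dimension $d-1-|\sigma|$ (equivalently, its reduced homology is $\mathbb{F}$ in degree $d-1-|\sigma|$ and $0$ in all other degrees). For a field $\Bbbk$ let $\Bbbk[\Delta]=\Bbbk[x_1,\dots,x_m]/I_\Delta$ be the face ring, where $I_\Delta$ is generated by the square-free monomials $\prod_{v\in\tau}x_v$ with $\tau\notin\Delta$. For a sequence $\Theta=(\theta_1,\dots,\theta_d)$ of linear forms put $\Bbbk(\Delta;\Theta)=\Bbbk[\Delta]/(\Theta)$, graded by degree; $\Theta$ is a linear system of parameters (l.s.o.p.), and $\Bbbk(\Delta;\Theta)$ an Artinian reduction of $\Bbbk[\Delta]$, if $d=\dim\Delta+1$ and $\dim_\Bbbk\Bbbk(\Delta;\Theta)<\infty$. The Artinian reduction $\Bbbk(\Delta;\Theta)$ is anisotropic if $u^2\neq0$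 for every nonzero $u\in\Bbbk(\Delta;\Theta)_i$ with $i\le d/2$. Let $\Bbbk=\mathbb{F}(a_{ij}:1\le i\le d,\ 1\le j\le m)$ be a field of rational functions in independent variables and let $\Theta=(\theta_i)_{i=1}^d$ with $\theta_i=\sum_{j=1}^m a_{ij}x_j$. Let $\Bbbk'=\mathbb{F}(a_{ij}:1\le i\le d,\ d+1\le j\le m)$ and let $\Theta'$ be the sequence of $d$ linear forms over $\Bbbk'$ whose coefficient matrix is $(I_d\mid A)$, where $I_d$ is the $d\times d$ identity matrix and $A=(a_{ij})_{1\le i\le d,\ d+1\le j\le m}$. Then $\Theta$ is an l.s.o.p. for $\Bbbk[\Delta]$, $\Theta'$ is an l.s.o.p. for $\Bbbk'[\Delta]$, and the Artinian reduction $\Bbbk(\Delta;\Theta)$ is anisotropic if and only if the Artinian reduction $\Bbbk'(\Delta;\Theta')$ is anisotropic. -/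

import Mathlib

open MvPolynomial

noncomputable section

namespace PreAbstractSimplicialComplex

/-- All faces of `K`, including the empty face (which Mathlib's complexes do not list). -/
def allFaces {ι : Type*} (K : PreAbstractSimplicialComplex ι) : Set (Finset ι) :=
  insert ∅ K.faces

/-- The link `{τ ∈ K : τ ∪ σ ∈ K, τ ∩ σ = ∅}` of `σ` in `K`. -/
def link {ι : Type*} [DecidableEq ι] (K : PreAbstractSimplicialComplex ι) (σ : Finset ι) :
    PreAbstractSimplicialComplex ι where
  faces := {τ | τ.Nonempty ∧ τ ∪ σ ∈ K.faces ∧ Disjoint τ σ}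
  isRelLowerSet_faces := by
    rintro τ ⟨hne, hmem, hdis⟩
    refine ⟨hne, fun ρ hρ hρne => ⟨hρne, ?_, hdis.mono_left hρ⟩⟩
    exact (K.isRelLowerSet_faces hmem).2 (Finset.union_subset_union_left hρ)
      (hρne.mono Finset.subset_union_left)

/-- The simplicial boundary map
`∂[v₀ < ⋯ < vₙ] = ∑ᵢ (-1)ⁱ [v₀, …, v̂ᵢ, …, vₙ]` on formal combinations of finite sets. It is
augmented: `∂[v] = [∅]`, and `∂[∅] = 0`. -/
def boundary (F : Type*) [Field F] (ι : Type*) [LinearOrder ι] :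
    (Finset ι →₀ F) →ₗ[F] (Finset ι →₀ F) :=
  Finsupp.linearCombination F fun s : Finset ι =>
    ∑ v ∈ s, Finsupp.single (s.erase v) ((-1 : F) ^ (s.filter (· < v)).card)

/-- The augmented simplicial chains of `K` spanned by the faces with `n` vertices
(that is, the chains of dimension `n - 1`). -/
def chains (F : Type*) [Field F] {ι : Type*} (K : PreAbstractSimplicialComplex ι) (n : ℕ) :
    Submodule F (Finset ι →₀ F) :=
  Finsupp.supported F F {s | s ∈ K.allFaces ∧ s.card = n}

/-- The cycles of dimension `n - 1`. -/
def cycles (F : Type*) [Field F] {ι : Type*} [LinearOrder ι]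
    (K : PreAbstractSimplicialComplex ι) (n : ℕ) : Submodule F (Finset ι →₀ F) :=
  K.chains F n ⊓ LinearMap.ker (boundary F ι)

/-- The boundaries of dimension `n - 1`. -/
def boundaries (F : Type*) [Field F] {ι : Type*} [LinearOrder ι]
    (K : PreAbstractSimplicialComplex ι) (n : ℕ) : Submodule F (Finset ι →₀ F) :=
  (K.chains F (n + 1)).map (boundary F ι)

/-- The reduced simplicial homology of `K` with coefficients in `F` in degree `n - 1`: cycles modulo
boundaries, as a subspace of the chains modulo boundaries. -/
def reducedHomology (F : Type*) [Field F] {ι : Type*} [LinearOrder ι]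
    (K : PreAbstractSimplicialComplex ι) (n : ℕ) :
    Submodule F ((Finset ι →₀ F) ⧸ K.boundaries F n) :=
  (K.cycles F n).map (K.boundaries F n).mkQ

/-- `K` is an `F`-homology `(d-1)`-sphere: for every face `σ` of `K`, including `∅`, the link of
`σ` has the reduced homology of a sphere of dimension `d - 1 - |σ|`, which is `F` in that degree
and `0` in all others (the sphere of dimension `-1` is empty, the complex whose only face
is `∅`). -/
def IsHomologySphere (F : Type*) [Field F] {ι : Type*} [LinearOrder ι] [Finite ι]
    (K : PreAbstractSimplicialComplex ι) (d : ℕ) : Prop :=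
  ∀ σ ∈ K.allFaces, ∀ n : ℕ,
    Module.finrank F ((K.link σ).reducedHomology F n) = if n + σ.card = d then 1 else 0

/-- The Stanley-Reisner ideal, generated by the square-free monomials of the non-faces. -/
def stanleyReisnerIdeal (k : Type*) [Field k] {ι : Type*} (K : PreAbstractSimplicialComplex ι) :
    Ideal (MvPolynomial ι k) :=
  Ideal.span {p | ∃ s : Finset ι, s ∉ K.allFaces ∧ p = ∏ v ∈ s, X v}

/-- The face ring `k[K]`. -/
abbrev FaceRing (k : Type*) [Field k] {ι : Type*} (K : PreAbstractSimplicialComplex ι) : Type _ :=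
  MvPolynomial ι k ⧸ K.stanleyReisnerIdeal k

/-- The quotient `k(K; Θ) = k[K] / (Θ)`. -/
abbrev Reduction {k : Type*} [Field k] {ι : Type*} (K : PreAbstractSimplicialComplex ι) {d : ℕ}
    (Θ : Fin d → MvPolynomial ι k) : Type _ :=
  K.FaceRing k ⧸ Ideal.span (Set.range fun i => Ideal.Quotient.mk (K.stanleyReisnerIdeal k) (Θ i))

/-- The homogeneous component `k(K; Θ)ᵢ` of degree `i`: the classes of the homogeneous polynomials
of degree `i`. -/
def reductionDegree {k : Type*} [Field k] {ι : Type*} (K : PreAbstractSimplicialComplex ι) {d : ℕ}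
    (Θ : Fin d → MvPolynomial ι k) (i : ℕ) : Submodule k (K.Reduction Θ) :=
  (homogeneousSubmodule ι k i).map
    ((Ideal.Quotient.mkₐ k _).comp (Ideal.Quotient.mkₐ k (K.stanleyReisnerIdeal k)) :
      MvPolynomial ι k →ₐ[k] K.Reduction Θ).toLinearMap

/-- `Θ` is a linear system of parameters for `k[K]`: its length `d` is `dim K + 1`, its members are
linear forms, and `k(K; Θ)` is a finite-dimensional `k`-space, i.e. an Artinian reduction
of `k[K]`. -/
structure IsLSOP {k : Type*} [Field k] {ι : Type*} (K : PreAbstractSimplicialComplex ι) {d : ℕ}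
    (Θ : Fin d → MvPolynomial ι k) : Prop where
  card_eq : IsGreatest (Finset.card '' K.allFaces) d
  isHomogeneous : ∀ i, (Θ i).IsHomogeneous 1
  finite : Module.Finite k (K.Reduction Θ)

/-- `k(K; Θ)` is anisotropic: `u ^ 2 ≠ 0` for every nonzero homogeneous element `u` of degree
`i ≤ d / 2`. -/
def IsAnisotropic {k : Type*} [Field k] {ι : Type*} (K : PreAbstractSimplicialComplex ι) {d : ℕ}
    (Θ : Fin d → MvPolynomial ι k) : Prop :=
  ∀ i : ℕ, 2 * i ≤ d → ∀ u ∈ K.reductionDegree Θ i, u ≠ 0 → u ^ 2 ≠ 0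

end PreAbstractSimplicialComplex

/-- The linear forms `θᵢ = ∑ⱼ Mᵢⱼ xⱼ` given by the rows of a matrix `M`. -/
def linearForms {k : Type*} [Field k] {d m : ℕ} (M : Matrix (Fin d) (Fin m) k) :
    Fin d → MvPolynomial (Fin m) k :=
  fun i => ∑ j, C (M i j) * X j

/-- The field `F(aᵢⱼ : 1 ≤ i ≤ d, 1 ≤ j ≤ m)` of rational functions. -/
abbrev GenericField (F : Type*) [Field F] (d m : ℕ) : Type _ :=
  FractionRing (MvPolynomial (Fin d × Fin m) F)

/-- The generic matrix `(aᵢⱼ)` of size `d × m`. -/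
def genericMatrix (F : Type*) [Field F] (d m : ℕ) : Matrix (Fin d) (Fin m) (GenericField F d m) :=
  fun i j => algebraMap (MvPolynomial (Fin d × Fin m) F) _ (X (i, j))

/-- The field `F(aᵢⱼ : 1 ≤ i ≤ d, d + 1 ≤ j ≤ m)` of rational functions. (Columns are counted
from `0` here, so the columns `d + 1, …, m` are those with index at least `d`.) -/
abbrev SmallGenericField (F : Type*) [Field F] (d m : ℕ) : Type _ :=
  FractionRing (MvPolynomial (Fin d × {j : Fin m // d ≤ (j : ℕ)}) F)

/-- The matrix `(I_d ∣ A)` of size `d × m`, with `A = (aᵢⱼ)`, `1 ≤ i ≤ d`, `d + 1 ≤ j ≤ m`. -/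
def reducedGenericMatrix (F : Type*) [Field F] (d m : ℕ) :
    Matrix (Fin d) (Fin m) (SmallGenericField F d m) :=
  fun i j =>
    if h : d ≤ (j : ℕ) then
      algebraMap (MvPolynomial (Fin d × {j : Fin m // d ≤ (j : ℕ)}) F) _ (X (i, ⟨j, h⟩))
    else if (i : ℕ) = (j : ℕ) then 1 else 0

end

/-! Write the generic matrix as `(B ∣ A)`, with `B` the square block of the first `d` columns. An
invertible row operation does not change the ideal `I_Δ + (Θ)`, so `(B ∣ A)` may be replaced by `(I
∣ B⁻¹A)`. Two embeddings of fields then compare the reductions: `A ↦ B⁻¹A` from `𝕜'` to `𝕜`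
(`exists_map_reducedGenericMatrix`), and `(B ∣ A) ↦ (B ∣ BA)` from `𝕜` to `𝕜'(B)`
(`exists_map_genericMatrix`).

Anisotropy descends along every field extension, because an ideal extended to a larger field
contracts back to itself (`map_mem_map_iff`). It ascends to the purely transcendental extension
`𝕜'(B)`: if a square vanishes, so does the square of its leading coefficient in the new variables,
which is a homogeneous element over the old field (`mem_map_of_sq_mem_map`).

For the l.s.o.p. claims, facets have `d` vertices, so the columns at any face are independent.
Modulo any prime the surviving variables form a face and satisfy independent linear relations, so
every variable is nilpotent. -/

namespace MvPolynomial

-- Ideals of polynomial rings under extension of the coefficients.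

attribute [local instance] algebraMvPolynomial

/-- Apply an additive map to every coefficient of a polynomial. -/
noncomputable def mapCoeff {σ S R : Type*} [CommSemiring S] [CommSemiring R] (h : S →+ R) :
    MvPolynomial σ S →+ MvPolynomial σ R where
  toFun p := AddMonoidAlgebra.map h p
  map_zero' := by ext; simp [MvPolynomial.coeff]
  map_add' p q := by ext; simp [MvPolynomial.coeff]

theorem coeff_mapCoeff {σ S R : Type*} [CommSemiring S] [CommSemiring R] (h : S →+ R)
    (p : MvPolynomial σ S) (n : σ →₀ ℕ) : coeff n (mapCoeff h p) = h (coeff n p) := by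
  simp [mapCoeff, MvPolynomial.coeff]

theorem mapCoeff_mul_map {σ K S R : Type*} [Field K] [CommRing S] [CommRing R] [Algebra K S]
    [Algebra K R] (h : S →ₗ[K] R) (s : MvPolynomial σ S) (q : MvPolynomial σ K) :
    mapCoeff h.toAddMonoidHom (s * map (algebraMap K S) q) =
      mapCoeff h.toAddMonoidHom s * map (algebraMap K R) q := by
  classical
  ext n
  simp only [coeff_mapCoeff, coeff_mul, map_sum, coeff_map]
  refine Finset.sum_congr rfl fun x _ => ?_
  rw [mul_comm, ← Algebra.smul_def, mul_comm, ← Algebra.smul_def]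
  exact h.map_smul _ _

/-- Over a field the injection `g` has a `K`-linear retraction. Applied coefficientwise it is linear
over `K[σ]`, so it carries the extension of `J` to `S` into the extension of `J` to `R`. -/
theorem map_mem_map_iff {σ K S R : Type*} [Field K] [CommRing S] [CommRing R] [Algebra K S]
    [Algebra K R] (g : R →ₐ[K] S) (hg : Function.Injective g) (J : Ideal (MvPolynomial σ K))
    (p : MvPolynomial σ R) :
    map (g : R →+* S) p ∈ J.map (map (algebraMap K S)) ↔ p ∈ J.map (map (algebraMap K R)) := by
  constructor
  · intro hp
    obtain ⟨h, hh⟩ := g.toLinearMap.exists_leftInverse_of_injective (LinearMap.ker_eq_bot.2 hg)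
    -- The multiplier `c` is built in because the retraction is not `S`-linear, while the span is
    -- taken over `S[σ]`.
    have key : ∀ y ∈ J.map (map (algebraMap K S) : MvPolynomial σ K →+* MvPolynomial σ S), ∀ c,
        mapCoeff h.toAddMonoidHom (c * y) ∈
          J.map (map (algebraMap K R) : MvPolynomial σ K →+* MvPolynomial σ R) := by
      intro y hy
      refine Submodule.span_induction ?_ ?_ ?_ ?_ hy
      · rintro _ ⟨j, hj, rfl⟩ c
        rw [mapCoeff_mul_map]
        exact Ideal.mul_mem_left _ _ (Ideal.mem_map_of_mem _ hj)
      · simp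
      · intro x y _ _ hx hy c
        rw [mul_add, map_add]
        exact add_mem (hx c) (hy c)
      · intro a x _ hx c
        rw [smul_eq_mul, ← mul_assoc]
        exact hx _
    have := key _ hp 1
    rw [one_mul] at this
    convert this
    ext n
    rw [coeff_mapCoeff, coeff_map]
    exact (LinearMap.congr_fun hh _).symm
  · intro hp
    have := Ideal.mem_map_of_mem (map (g : R →+* S)) hp
    rw [Ideal.map_map] at this
    convert this
    ext <;> simp

theorem coeff_coeff_commAlgEquiv {K σ τ : Type*} [CommSemiring K]
    (P : MvPolynomial σ (MvPolynomial τ K)) (n : σ →₀ ℕ) (e : τ →₀ ℕ) :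
    coeff n (coeff e (commAlgEquiv K σ τ P)) = coeff e (coeff n P) := by
  classical
  induction P using MvPolynomial.induction_on' with
  | monomial u a =>
    induction a using MvPolynomial.induction_on' with
    | monomial v b =>
      have : commAlgEquiv K σ τ (monomial u (monomial v b)) = monomial v (monomial u b) :=
        AddMonoidAlgebra.commAlgEquiv_single_single _ _ _
      rw [this]
      simp only [coeff_monomial]
      split_ifs <;> simp [coeff_monomial, *]
    | add p q hp hq => simp only [map_add, coeff_add, hp, hq]
  | add p q hp hq => simp only [map_add, coeff_add, hp, hq]

theorem commAlgEquiv_map_algebraMap {K σ τ : Type*} [CommSemiring K] (q : MvPolynomial σ K) :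
    commAlgEquiv K σ τ (map (algebraMap K (MvPolynomial τ K)) q) = C q := by
  classical
  ext e n
  rw [coeff_coeff_commAlgEquiv, coeff_map, coeff_C, algebraMap_eq, coeff_C]
  split_ifs <;> simp

/-- If `J` contains every homogeneous polynomial of degree `i` whose square it contains, then so
does the ideal which `J` generates over a purely transcendental extension of the base field. -/
theorem mem_map_of_sq_mem_map {K σ τ : Type*} [Field K] (mo : MonomialOrder τ)
    (J : Ideal (MvPolynomial σ K)) (i : ℕ)
    (hJ : ∀ q : MvPolynomial σ K, q.IsHomogeneous i → q ^ 2 ∈ J → q ∈ J)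
    (p : MvPolynomial σ (FractionRing (MvPolynomial τ K))) (hp : p.IsHomogeneous i)
    (h2 : p ^ 2 ∈ J.map (map (algebraMap K (FractionRing (MvPolynomial τ K))))) :
    p ∈ J.map (map (algebraMap K (FractionRing (MvPolynomial τ K)))) := by
  -- Clear denominators: `P = r p` has coefficients in `K[τ]`, and `r` is a unit in the fraction
  -- field.
  obtain ⟨⟨_, r, hr, rfl⟩, P, hP⟩ := IsLocalization.exists_integer_multiple
    ((nonZeroDivisors (MvPolynomial τ K)).map (C (σ := σ))) p
  have hr0 : algebraMap _ (FractionRing (MvPolynomial τ K)) r ≠ 0 :=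
    IsFractionRing.to_map_ne_zero_of_mem_nonZeroDivisors hr
  have hP' : map (algebraMap _ (FractionRing (MvPolynomial τ K))) P =
      C (algebraMap _ (FractionRing (MvPolynomial τ K)) r) * p := by
    rw [Algebra.smul_def] at hP
    rw [← map_C]
    exact hP
  have hinj := IsFractionRing.injective (MvPolynomial τ K) (FractionRing (MvPolynomial τ K))
  have hiff := map_mem_map_iff (IsScalarTower.toAlgHom K (MvPolynomial τ K)
    (FractionRing (MvPolynomial τ K))) hinj J
  have hcoe : ((IsScalarTower.toAlgHom K (MvPolynomial τ K)
    (FractionRing (MvPolynomial τ K)) : _ →ₐ[K] _) : MvPolynomial τ K →+* _) =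
      algebraMap _ (FractionRing (MvPolynomial τ K)) := rfl
  rw [hcoe] at hiff
  have hunit : IsUnit (C (σ := σ) (algebraMap _ (FractionRing (MvPolynomial τ K)) r)) :=
    (isUnit_iff_ne_zero.2 hr0).map C
  rw [← Ideal.unit_mul_mem_iff_mem _ hunit, ← hP', hiff]
  have hPhom : P.IsHomogeneous i := by
    intro n hn
    refine hp (d := n) fun h0 => hn (hinj ?_)
    rw [← coeff_map, hP', coeff_C_mul, h0, mul_zero, map_zero]
  have hP2 : P ^ 2 ∈ J.map (map (algebraMap K (MvPolynomial τ K))) := by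
    rw [← hiff, map_pow, hP', mul_pow]
    exact Ideal.mul_mem_left _ _ h2
  -- Exchange the two sets of variables: membership now means vanishing in `(K[σ]/J)[τ]`.
  have hmap : (J.map (map (algebraMap K (MvPolynomial τ K)))).map
      (commAlgEquiv K σ τ : _ →+* MvPolynomial τ (MvPolynomial σ K)) = J.map C := by
    rw [Ideal.map_map]
    congr 1
    exact RingHom.ext commAlgEquiv_map_algebraMap
  have hcomm : ∀ Q, Q ∈ J.map (map (algebraMap K (MvPolynomial τ K))) ↔
      commAlgEquiv K σ τ Q ∈ J.map (C : _ →+* MvPolynomial τ (MvPolynomial σ K)) := by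
    intro Q
    rw [← hmap]
    refine ⟨fun h => Ideal.mem_map_of_mem _ h, fun h => ?_⟩
    obtain ⟨Q', hQ', hQ⟩ := (Ideal.mem_map_iff_of_surjective _
      (commAlgEquiv K σ τ).surjective).1 h
    rwa [← (commAlgEquiv K σ τ).injective hQ]
  have hker : ∀ t : MvPolynomial τ (MvPolynomial σ K),
      t ∈ J.map (C : _ →+* MvPolynomial τ (MvPolynomial σ K)) ↔
        map (Ideal.Quotient.mk J) t = 0 := by
    intro t
    rw [mem_map_C_iff, MvPolynomial.ext_iff]
    simp [coeff_map, Ideal.Quotient.eq_zero_iff_mem]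
  rw [hcomm, hker]
  rw [hcomm, hker, map_pow, map_pow] at hP2
  set t := map (Ideal.Quotient.mk J) (commAlgEquiv K σ τ P) with ht
  -- `K[σ]/J` may have zero divisors, but the coefficient of `t ^ 2` at twice the degree of `t` is
  -- still the square of the leading coefficient.
  have hlc : mo.leadingCoeff t ^ 2 = 0 := by
    rw [← mo.coeff_pow_nsmul_degree, hP2, coeff_zero]
  rw [← mo.leadingCoeff_eq_zero_iff]
  rw [MonomialOrder.leadingCoeff, ht, coeff_map, ← map_pow, Ideal.Quotient.eq_zero_iff_mem] at hlc
  rw [MonomialOrder.leadingCoeff, ht, coeff_map, Ideal.Quotient.eq_zero_iff_mem]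
  -- The leading coefficient lifts to a `τ`-coefficient of `P`, which is homogeneous of degree `i`
  -- in `σ` because `P` is.
  refine hJ _ ?_ hlc
  intro n hn
  rw [coeff_coeff_commAlgEquiv] at hn
  exact hPhom fun h0 => hn (by rw [h0, coeff_zero])

end MvPolynomial

/-! ### Anisotropy in terms of the ideal `I_K + (Θ)`; row operations and change of field. -/

namespace PreAbstractSimplicialComplex

/-- The ideal `I_K + (Θ)` of the polynomial ring, whose quotient is `k(K; Θ)`. -/
noncomputable def reductionIdeal {k : Type*} [Field k] {ι : Type*} (K : PreAbstractSimplicialComplex ι) {d : ℕ}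
    (Θ : Fin d → MvPolynomial ι k) : Ideal (MvPolynomial ι k) :=
  K.stanleyReisnerIdeal k ⊔ Ideal.span (Set.range Θ)

theorem mk_mk_eq_zero_iff {k : Type*} [Field k] {ι : Type*} (K : PreAbstractSimplicialComplex ι)
    {d : ℕ} (Θ : Fin d → MvPolynomial ι k) (p : MvPolynomial ι k) :
    (Ideal.Quotient.mk _ (Ideal.Quotient.mk _ p) : K.Reduction Θ) = 0 ↔
      p ∈ K.reductionIdeal Θ := by
  rw [Ideal.Quotient.eq_zero_iff_mem]
  have : Ideal.span (Set.range fun i => Ideal.Quotient.mk (K.stanleyReisnerIdeal k) (Θ i)) =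
      (Ideal.span (Set.range Θ)).map (Ideal.Quotient.mk (K.stanleyReisnerIdeal k)) := by
    rw [Ideal.map_span, ← Set.range_comp]
    rfl
  rw [this, ← Ideal.mem_comap,
    Ideal.comap_map_of_surjective _ Ideal.Quotient.mk_surjective, ← RingHom.ker_eq_comap_bot,
    Ideal.mk_ker, sup_comm, reductionIdeal]

/-- Anisotropy thus depends on `Θ` only through `reductionIdeal`, to which row operations and base
change apply directly. -/
theorem isAnisotropic_iff {k : Type*} [Field k] {ι : Type*} (K : PreAbstractSimplicialComplex ι)
    {d : ℕ} (Θ : Fin d → MvPolynomial ι k) :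
    K.IsAnisotropic Θ ↔ ∀ i, 2 * i ≤ d → ∀ p : MvPolynomial ι k, p.IsHomogeneous i →
      p ^ 2 ∈ K.reductionIdeal Θ → p ∈ K.reductionIdeal Θ := by
  constructor
  · intro h i hi p hp h2
    by_contra hne
    refine h i hi (Ideal.Quotient.mk _ (Ideal.Quotient.mk _ p)) ⟨p, hp, rfl⟩ ?_ ?_
    · rwa [Ne, mk_mk_eq_zero_iff]
    · rwa [← map_pow, ← map_pow, mk_mk_eq_zero_iff]
  · rintro h i hi _ ⟨p, hp, rfl⟩ hne h2
    refine hne ((K.mk_mk_eq_zero_iff Θ p).2 (h i hi p hp ((K.mk_mk_eq_zero_iff Θ _).1 ?_)))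
    rw [map_pow, map_pow]
    exact h2

theorem map_stanleyReisnerIdeal {k l : Type*} [Field k] [Field l] (φ : k →+* l) {ι : Type*}
    (K : PreAbstractSimplicialComplex ι) :
    (K.stanleyReisnerIdeal k).map (MvPolynomial.map φ) = K.stanleyReisnerIdeal l := by
  rw [stanleyReisnerIdeal, Ideal.map_span, stanleyReisnerIdeal]
  congr 1
  ext p
  constructor
  · rintro ⟨_, ⟨s, hs, rfl⟩, rfl⟩
    exact ⟨s, hs, by simp [map_prod]⟩
  · rintro ⟨s, hs, rfl⟩
    exact ⟨_, ⟨s, hs, rfl⟩, by simp [map_prod]⟩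

theorem map_reductionIdeal {k l : Type*} [Field k] [Field l] (φ : k →+* l) {d m : ℕ}
    (K : PreAbstractSimplicialComplex (Fin m)) (M : Matrix (Fin d) (Fin m) k) :
    (K.reductionIdeal (linearForms M)).map (MvPolynomial.map φ) = K.reductionIdeal (linearForms (M.map φ)) := by
  rw [reductionIdeal, Ideal.map_sup, map_stanleyReisnerIdeal, Ideal.map_span, ← Set.range_comp,
    reductionIdeal]
  congr 3
  ext1 i
  simp [linearForms, map_sum]

theorem reductionIdeal_mul_le {k : Type*} [Field k] {d m : ℕ}
    (K : PreAbstractSimplicialComplex (Fin m)) (B : Matrix (Fin d) (Fin d) k)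
    (M : Matrix (Fin d) (Fin m) k) :
    K.reductionIdeal (linearForms (B * M)) ≤ K.reductionIdeal (linearForms M) := by
  refine sup_le_sup_left (Ideal.span_le.2 ?_) _
  rintro _ ⟨i, rfl⟩
  have : linearForms (B * M) i = ∑ l, C (B i l) * linearForms M l := by
    simp only [linearForms, Matrix.mul_apply, map_sum, map_mul, Finset.sum_mul, Finset.mul_sum]
    rw [Finset.sum_comm]
    simp only [mul_assoc]
  rw [this]
  exact Ideal.sum_mem _ fun l _ => Ideal.mul_mem_left _ _ (Ideal.subset_span ⟨l, rfl⟩)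

theorem reductionIdeal_mul {k : Type*} [Field k] {d m : ℕ}
    (K : PreAbstractSimplicialComplex (Fin m)) (B : Matrix (Fin d) (Fin d) k) (hB : B.det ≠ 0)
    (M : Matrix (Fin d) (Fin m) k) :
    K.reductionIdeal (linearForms (B * M)) = K.reductionIdeal (linearForms M) := by
  refine le_antisymm (K.reductionIdeal_mul_le B M) ?_
  conv_lhs => rw [← Matrix.nonsing_inv_mul_cancel_left B M (isUnit_iff_ne_zero.2 hB)]
  exact K.reductionIdeal_mul_le _ _

theorem isAnisotropic_mul_iff {k : Type*} [Field k] {d m : ℕ}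
    (K : PreAbstractSimplicialComplex (Fin m)) (B : Matrix (Fin d) (Fin d) k) (hB : B.det ≠ 0)
    (M : Matrix (Fin d) (Fin m) k) :
    K.IsAnisotropic (linearForms (B * M)) ↔ K.IsAnisotropic (linearForms M) := by
  rw [isAnisotropic_iff, isAnisotropic_iff, reductionIdeal_mul K B hB]

/-- Anisotropy descends along extensions of the base field. -/
theorem IsAnisotropic.of_map {k l : Type*} [Field k] [Field l] (φ : k →+* l) {d m : ℕ}
    {K : PreAbstractSimplicialComplex (Fin m)} {M : Matrix (Fin d) (Fin m) k}
    (h : K.IsAnisotropic (linearForms (M.map φ))) : K.IsAnisotropic (linearForms M) := by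
  rw [isAnisotropic_iff] at h ⊢
  intro i hi p hp h2
  let := φ.toAlgebra
  have hiff : ∀ q : MvPolynomial (Fin m) k, MvPolynomial.map φ q ∈ K.reductionIdeal (linearForms (M.map φ)) ↔
      q ∈ K.reductionIdeal (linearForms M) := by
    intro q
    rw [← map_reductionIdeal]
    have := map_mem_map_iff (Algebra.ofId k l) φ.injective (K.reductionIdeal (linearForms M)) q
    rwa [Algebra.algebraMap_self, show MvPolynomial.map (RingHom.id k) = RingHom.id _ from
      RingHom.ext MvPolynomial.map_id, Ideal.map_id] at this
  rw [← hiff]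
  refine h i hi _ (hp.map φ) ?_
  rwa [← map_pow, hiff]

/-- Anisotropy ascends along purely transcendental extensions of the base field. -/
theorem IsAnisotropic.map_fractionRing {k τ : Type*} [Field k] (mo : MonomialOrder τ) {d m : ℕ}
    {K : PreAbstractSimplicialComplex (Fin m)} {M : Matrix (Fin d) (Fin m) k}
    (h : K.IsAnisotropic (linearForms M)) :
    K.IsAnisotropic
      (linearForms (M.map (algebraMap k (FractionRing (MvPolynomial τ k))))) := by
  rw [isAnisotropic_iff] at h ⊢
  intro i hi p hp h2
  rw [← map_reductionIdeal] at h2 ⊢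
  exact mem_map_of_sq_mem_map mo _ i (h i hi) p hp h2

/-! ### Finiteness of the reduction. -/

/-- A quotient of `k[K]` by linear forms is finite-dimensional if the columns indexed by any face
of `K` are linearly independent in the coefficient matrix of these forms. -/
theorem finite_of_surjective_of_linearIndependent {k A : Type*} [Field k] [CommRing A]
    [Algebra k A] {d m : ℕ} (K : PreAbstractSimplicialComplex (Fin m))
    (M : Matrix (Fin d) (Fin m) k)
    (hM : ∀ σ ∈ K.allFaces, LinearIndependent k fun v : σ => fun i => M i v)
    (π : MvPolynomial (Fin m) k →ₐ[k] A) (hπ : Function.Surjective π)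
    (hzero : ∀ p ∈ K.reductionIdeal (linearForms M), π p = 0) : Module.Finite k A := by
  classical
  have hnil : ∀ v, IsNilpotent (π (X v)) := by
    intro v
    rw [nilpotent_iff_mem_prime]
    intro P hP
    by_contra hv
    -- The variables surviving modulo `P`; they form a face, since otherwise their product would be
    -- zero in `A` and `P` would contain one of them.
    set σ : Finset (Fin m) := Finset.univ.filter fun w => π (X w) ∉ P with hσ
    have hface : σ ∈ K.allFaces := by
      by_contra hnot
      have h0 : π (∏ w ∈ σ, X w) = 0 :=
        hzero _ (Ideal.mem_sup_left (Ideal.subset_span ⟨σ, hnot, rfl⟩))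
      have hmem : ∏ w ∈ σ, π (X w) ∈ P := by
        rw [← map_prod, h0]
        exact P.zero_mem
      obtain ⟨w, hw, hwP⟩ := hP.prod_mem_iff.1 hmem
      exact (Finset.mem_filter.1 hw).2 hwP
    have hsum : ∀ i, ∑ w : σ, M i w • Ideal.Quotient.mk P (π (X w.1)) = 0 := by
      intro i
      have h0 : π (linearForms M i) = 0 :=
        hzero _ (Ideal.mem_sup_right (Ideal.subset_span ⟨i, rfl⟩))
      have h1 : ∑ w, M i w • Ideal.Quotient.mk P (π (X w)) = 0 := by
        rw [← map_zero (Ideal.Quotient.mk P), ← h0, linearForms, map_sum, map_sum]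
        refine Finset.sum_congr rfl fun w _ => ?_
        rw [← smul_eq_C_mul, map_smul]
        rfl
      rw [← h1, Finset.sum_coe_sort σ fun w => M i w • Ideal.Quotient.mk P (π (X w))]
      refine Finset.sum_subset (Finset.subset_univ _) fun w _ hw => ?_
      have : π (X w) ∈ P := by simpa [hσ] using hw
      rw [Ideal.Quotient.eq_zero_iff_mem.2 this, smul_zero]
    have hli := hM σ hface
    obtain ⟨g, hg⟩ := (Fintype.linearCombination k fun v : σ => fun i => M i v)
      |>.exists_leftInverse_of_injective
        (LinearMap.ker_eq_bot.2 (linearIndependent_iff_injective_fintypeLinearCombination.1 hli))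
    have hvσ : v ∈ σ := by simp [hσ, hv]
    refine hv (Ideal.Quotient.eq_zero_iff_mem.1 ?_)
    -- A left inverse of the column map supplies the combination of the linear forms that isolates
    -- `x_v` modulo `P`.
    have hcol : ∀ w : σ, ∑ i, g (Pi.single i 1) ⟨v, hvσ⟩ * M i w =
        if w = ⟨v, hvσ⟩ then 1 else 0 := by
      intro w
      have h1 := LinearMap.congr_fun hg (Pi.single w 1)
      have h2 : Fintype.linearCombination k (fun v : σ => fun i => M i v) (Pi.single w 1) =
          ∑ i, M i w • Pi.single i (1 : k) := by
        rw [Fintype.linearCombination_apply_single, one_smul]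
        exact pi_eq_sum_univ' _
      rw [LinearMap.comp_apply, h2, map_sum] at h1
      have h3 := congr_fun h1 ⟨v, hvσ⟩
      simp only [map_smul, Finset.sum_apply, Pi.smul_apply, smul_eq_mul, LinearMap.id_apply,
        Pi.single_apply] at h3
      simp only [mul_comm, h3, eq_comm]
    calc Ideal.Quotient.mk P (π (X v))
        = ∑ w : σ, (∑ i, g (Pi.single i 1) ⟨v, hvσ⟩ * M i w) •
            Ideal.Quotient.mk P (π (X w.1)) := by simp [hcol, ite_smul]
      _ = ∑ i, g (Pi.single i 1) ⟨v, hvσ⟩ •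
            ∑ w : σ, M i w • Ideal.Quotient.mk P (π (X w.1)) := by
          simp only [Finset.sum_smul, Finset.smul_sum, mul_smul]
          exact Finset.sum_comm
      _ = 0 := by simp only [hsum, smul_zero, Finset.sum_const_zero]
  -- Nilpotent generators are integral, and an integral algebra of finite type is finite.
  have hint : Algebra.IsIntegral k A := by
    refine ⟨fun a => ?_⟩
    obtain ⟨p, rfl⟩ := hπ a
    induction p using MvPolynomial.induction_on with
    | C c => exact (π.commutes c).symm ▸ isIntegral_algebraMap
    | add p q hp hq => rw [map_add]; exact hp.add hq
    | mul_X p v hp =>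
      rw [map_mul]
      refine hp.mul ?_
      obtain ⟨n, hn⟩ := hnil v
      refine ⟨Polynomial.X ^ n, Polynomial.monic_X_pow n, ?_⟩
      simp [hn]
  have : Algebra.FiniteType k A := Algebra.FiniteType.of_surjective π hπ
  exact Algebra.IsIntegral.finite

/-- If the columns of `M` indexed by any face of `K` are linearly independent, then `k(K; Θ)` is
finite-dimensional. -/
theorem finite_reduction {k : Type*} [Field k] {d m : ℕ}
    (K : PreAbstractSimplicialComplex (Fin m)) (M : Matrix (Fin d) (Fin m) k)
    (hM : ∀ σ ∈ K.allFaces, LinearIndependent k fun v : σ => fun i => M i v) :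
    Module.Finite k (K.Reduction (linearForms M)) :=
  K.finite_of_surjective_of_linearIndependent (A := K.Reduction (linearForms M)) M hM
    ((Ideal.Quotient.mkₐ k _).comp (Ideal.Quotient.mkₐ k (K.stanleyReisnerIdeal k)))
    (Ideal.Quotient.mk_surjective.comp Ideal.Quotient.mk_surjective)
    fun p hp => (K.mk_mk_eq_zero_iff _ p).2 hp

/-! ### Facets of homology spheres. -/

/-- All facets of a homology `(d-1)`-sphere have `d` vertices. -/
theorem IsHomologySphere.card_of_maximal {F ι : Type*} [Field F] [LinearOrder ι] [Finite ι]
    {K : PreAbstractSimplicialComplex ι} {d : ℕ} (h : K.IsHomologySphere F d) {σ : Finset ι}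
    (hσ : Maximal (· ∈ K.allFaces) σ) : σ.card = d := by
  have hlink : (K.link σ).allFaces = {∅} := by
    refine Set.Subset.antisymm ?_ (by simp [allFaces])
    rintro τ (rfl | ⟨hne, hτ, hdis⟩)
    · rfl
    · have hsub : τ ⊆ σ :=
        Finset.subset_union_left.trans (hσ.2 (Or.inr hτ) Finset.subset_union_right)
      exact absurd (disjoint_self.1 (hdis.mono_right hsub)) hne.ne_empty
  have hbd : (K.link σ).boundaries F 0 = ⊥ := by
    rw [boundaries, chains, hlink]
    have : {s : Finset ι | s ∈ ({∅} : Set (Finset ι)) ∧ s.card = 0 + 1} = ∅ := by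
      ext s
      simp only [Set.mem_singleton_iff, Set.mem_ofPred_eq, Set.mem_empty_iff_false, iff_false]
      rintro ⟨rfl, h⟩
      simp at h
    rw [this]
    simp
  have hcyc : Finsupp.single ∅ 1 ∈ (K.link σ).cycles F 0 := by
    refine ⟨?_, ?_⟩
    · exact Finsupp.single_mem_supported F _ ⟨Or.inl rfl, rfl⟩
    · simp [boundary]
  -- The index `0` is homological degree `-1`: the link of a facet has only the empty face, whose
  -- class is non-zero there, and this forces `|σ| = d`.
  have hrk := h σ hσ.1 0
  by_contra hne
  rw [zero_add, if_neg hne] at hrk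
  have hbot : (K.link σ).reducedHomology F 0 = ⊥ := Submodule.finrank_eq_zero.1 hrk
  have hmem : (((K.link σ).boundaries F 0).mkQ (Finsupp.single ∅ 1)) ∈
      (K.link σ).reducedHomology F 0 := ⟨_, hcyc, rfl⟩
  rw [hbot, Submodule.mem_bot, Submodule.mkQ_apply, Submodule.Quotient.mk_eq_zero, hbd,
    Submodule.mem_bot] at hmem
  simp at hmem

theorem IsHomologySphere.isGreatest_card {F ι : Type*} [Field F] [LinearOrder ι] [Finite ι]
    {K : PreAbstractSimplicialComplex ι} {d : ℕ} (h : K.IsHomologySphere F d) :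
    IsGreatest (Finset.card '' K.allFaces) d := by
  have hmax : ∀ σ ∈ K.allFaces, ∃ τ, σ ⊆ τ ∧ τ ∈ K.allFaces ∧ τ.card = d := by
    intro σ hσ
    obtain ⟨τ, hle, hτ⟩ := (Set.toFinite K.allFaces).exists_le_maximal hσ
    exact ⟨τ, hle, hτ.1, h.card_of_maximal hτ⟩
  constructor
  · obtain ⟨τ, -, hτ, hd⟩ := hmax ∅ (Or.inl rfl)
    exact ⟨τ, hτ, hd⟩
  · rintro _ ⟨σ, hσ, rfl⟩
    obtain ⟨τ, hle, -, hd⟩ := hmax σ hσ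
    exact hd ▸ Finset.card_le_card hle

end PreAbstractSimplicialComplex

theorem isHomogeneous_linearForms {k : Type*} [Field k] {d m : ℕ} (M : Matrix (Fin d) (Fin m) k)
    (i : Fin d) : (linearForms M i).IsHomogeneous 1 :=
  IsHomogeneous.sum _ _ _ fun j _ => by simpa using (isHomogeneous_X k j).C_mul (M i j)

/-- Supplies the order for the leading coefficient argument. -/
theorem nonempty_monomialOrder.{u} (τ : Type u) [Finite τ] : Nonempty (MonomialOrder.{u, u} τ) := by
  obtain ⟨n, ⟨e⟩⟩ := Finite.exists_equiv_fin τ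
  let : LinearOrder τ := LinearOrder.lift' e e.injective
  exact ⟨MonomialOrder.lex⟩

/-! ### The generic matrix, its square block and the two substitutions. -/

noncomputable section

theorem injective_algebraMap_genericField (F : Type*) [Field F] (d m : ℕ) :
    Function.Injective
      (algebraMap (MvPolynomial (Fin d × Fin m) F) (GenericField F d m)) :=
  IsFractionRing.injective _ _

/-- All maximal minors of the generic matrix are non-zero. -/
theorem det_submatrix_genericMatrix_ne_zero (F : Type*) [Field F] {d m : ℕ} {n : Type*}
    [Fintype n] [DecidableEq n] {e : n → Fin d} {f : n → Fin m} (he : Function.Injective e)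
    (hf : Function.Injective f) : ((genericMatrix F d m).submatrix e f).det ≠ 0 := by
  -- The submatrix is the generic square matrix with its variables renamed injectively.
  have h : (genericMatrix F d m).submatrix e f =
      (Matrix.mvPolynomialX n n F).map ((algebraMap _ (GenericField F d m)).comp
        (rename (Prod.map e f) : MvPolynomial (n × n) F →ₐ[F] _).toRingHom) := by
    ext i j
    simp [genericMatrix, Matrix.mvPolynomialX]
  rw [h, ← RingHom.mapMatrix_apply, ← RingHom.map_det]
  refine (map_ne_zero_iff _ ?_).2 (Matrix.det_mvPolynomialX_ne_zero n F)
  exact (injective_algebraMap_genericField F d m).comp (rename_injective _ (he.prodMap hf))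

/-- Some choice of `|σ|` rows gives a non-zero minor, and columns independent after deleting rows
are independent. -/
theorem linearIndependent_genericMatrix (F : Type*) [Field F] {d m : ℕ} (σ : Finset (Fin m))
    (hσ : σ.card ≤ d) :
    LinearIndependent (GenericField F d m) fun v : σ => fun i => genericMatrix F d m i v := by
  obtain ⟨e⟩ : Nonempty (σ ↪ Fin d) := Function.Embedding.nonempty_of_card_le (by simpa using hσ)
  have hdet := det_submatrix_genericMatrix_ne_zero F (f := fun v : σ => (v : Fin m)) e.injective
    Subtype.val_injective
  have hli := Matrix.linearIndependent_cols_of_det_ne_zero hdet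
  exact LinearIndependent.of_comp (LinearMap.funLeft _ _ e) hli

/-- The square block formed by the first `d` columns of the generic matrix. -/
def genericBlock (F : Type*) [Field F] {d m : ℕ} (hdm : d ≤ m) :
    Matrix (Fin d) (Fin d) (GenericField F d m) :=
  (genericMatrix F d m).submatrix id (Fin.castLE hdm)

theorem det_genericBlock_ne_zero (F : Type*) [Field F] {d m : ℕ} (hdm : d ≤ m) :
    (genericBlock F hdm).det ≠ 0 :=
  det_submatrix_genericMatrix_ne_zero F Function.injective_id (Fin.castLE_injective hdm)

/-- The endomorphism `(B ∣ A) ↦ (B ∣ BA)` of the polynomial ring. -/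
def mulBlock (F : Type*) [Field F] {d m : ℕ} (hdm : d ≤ m) :
    MvPolynomial (Fin d × Fin m) F →ₐ[F] MvPolynomial (Fin d × Fin m) F :=
  aeval fun x => if d ≤ (x.2 : ℕ) then ∑ l, X (x.1, Fin.castLE hdm l) * X (l, x.2) else X x

/-- The homomorphism `(B ∣ A) ↦ (B ∣ B⁻¹A)` from the polynomial ring to its field of fractions. -/
def invMulBlock (F : Type*) [Field F] {d m : ℕ} (hdm : d ≤ m) :
    MvPolynomial (Fin d × Fin m) F →ₐ[F] GenericField F d m :=
  aeval fun x => if d ≤ (x.2 : ℕ) then ((genericBlock F hdm)⁻¹ * genericMatrix F d m) x.1 x.2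
    else genericMatrix F d m x.1 x.2

theorem invMulBlock_mulBlock (F : Type*) [Field F] {d m : ℕ} (hdm : d ≤ m)
    (p : MvPolynomial (Fin d × Fin m) F) :
    invMulBlock F hdm (mulBlock F hdm p) = algebraMap _ (GenericField F d m) p := by
  suffices h : (invMulBlock F hdm).comp (mulBlock F hdm) =
      IsScalarTower.toAlgHom F _ (GenericField F d m) from DFunLike.congr_fun h p
  ext ⟨i, j⟩
  by_cases hj : d ≤ (j : ℕ)
  · have h : (genericBlock F hdm * ((genericBlock F hdm)⁻¹ * genericMatrix F d m)) i j =
        genericMatrix F d m i j := by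
      rw [Matrix.mul_nonsing_inv_cancel_left _ _
        (isUnit_iff_ne_zero.2 (det_genericBlock_ne_zero F hdm))]
    rw [Matrix.mul_apply] at h
    have hX : ∀ l, invMulBlock F hdm (X (i, Fin.castLE hdm l)) = genericBlock F hdm i l := by
      intro l
      simp [invMulBlock, genericBlock]
    have hX' : ∀ l, invMulBlock F hdm (X (l, j)) =
        ((genericBlock F hdm)⁻¹ * genericMatrix F d m) l j := by
      intro l
      rw [invMulBlock, aeval_X, if_pos hj]
    rw [AlgHom.comp_apply, mulBlock, aeval_X, if_pos hj, map_sum]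
    simp only [map_mul, hX, hX']
    exact h
  · simp [mulBlock, invMulBlock, hj, genericMatrix]

theorem mulBlock_injective (F : Type*) [Field F] {d m : ℕ} (hdm : d ≤ m) :
    Function.Injective (mulBlock F hdm) := by
  refine Function.Injective.of_comp (f := invMulBlock F hdm) ?_
  convert injective_algebraMap_genericField F d m
  ext1 p
  exact invMulBlock_mulBlock F hdm p

/-- This is the algebraic independence of the entries of `B` and `B⁻¹A`. The extension `φ` of
`mulBlock` to the fraction field fixes `B`, hence `B⁻¹`, and sends `B⁻¹A` to `B⁻¹(BA) = A`; so `φ`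
undoes the map. -/
theorem invMulBlock_injective (F : Type*) [Field F] {d m : ℕ} (hdm : d ≤ m) :
    Function.Injective (invMulBlock F hdm) := by
  have hg : Function.Injective ((IsScalarTower.toAlgHom F _ (GenericField F d m)).comp
      (mulBlock F hdm)) :=
    (injective_algebraMap_genericField F d m).comp (mulBlock_injective F hdm)
  let φ : GenericField F d m →ₐ[F] GenericField F d m := IsFractionRing.liftAlgHom hg
  have hφ : ∀ p, φ (algebraMap _ _ p) = algebraMap _ (GenericField F d m) (mulBlock F hdm p) :=
    fun p => IsFractionRing.lift_algebraMap hg p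
  have hM : ∀ i j, φ (genericMatrix F d m i j) = if d ≤ (j : ℕ) then
      (genericBlock F hdm * genericMatrix F d m) i j else genericMatrix F d m i j := by
    intro i j
    rw [genericMatrix, hφ]
    split_ifs with hj <;> simp [mulBlock, hj, Matrix.mul_apply, genericBlock, genericMatrix]
  have hB : (genericBlock F hdm).map φ = genericBlock F hdm := by
    ext i j
    have : ¬ d ≤ ((Fin.castLE hdm j : Fin m) : ℕ) := by simp
    simp only [Matrix.map_apply, genericBlock, Matrix.submatrix_apply, hM, this, if_false]
  have hBinv : ((genericBlock F hdm)⁻¹).map φ = (genericBlock F hdm)⁻¹ := by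
    have h1 : (genericBlock F hdm).map φ * ((genericBlock F hdm)⁻¹).map φ = 1 := by
      rw [← Matrix.map_mul, Matrix.mul_nonsing_inv _
        (isUnit_iff_ne_zero.2 (det_genericBlock_ne_zero F hdm))]
      exact Matrix.map_one _ (map_zero φ) (map_one φ)
    rw [hB] at h1
    exact (Matrix.inv_eq_right_inv h1).symm
  refine Function.Injective.of_comp (f := φ) ?_
  convert injective_algebraMap_genericField F d m
  suffices h : φ.comp (invMulBlock F hdm) = IsScalarTower.toAlgHom F _ (GenericField F d m) from
    congr_arg DFunLike.coe h
  ext ⟨i, j⟩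
  by_cases hj : d ≤ (j : ℕ)
  · have h1 : φ (((genericBlock F hdm)⁻¹ * genericMatrix F d m) i j) =
        ((genericBlock F hdm)⁻¹ * (genericBlock F hdm * genericMatrix F d m)) i j := by
      rw [Matrix.mul_apply, map_sum, Matrix.mul_apply]
      refine Finset.sum_congr rfl fun l _ => ?_
      rw [map_mul, hM, if_pos hj]
      exact congr_arg (· * _) (congr_fun (congr_fun hBinv i) l)
    rw [Matrix.nonsing_inv_mul_cancel_left _ _
      (isUnit_iff_ne_zero.2 (det_genericBlock_ne_zero F hdm))] at h1
    rw [AlgHom.comp_apply, invMulBlock, aeval_X, if_pos hj]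
    exact h1
  · rw [AlgHom.comp_apply, invMulBlock, aeval_X, if_neg hj, hM, if_neg hj]
    rfl

/-- The embedding of fields under which `(I ∣ A)` becomes `B⁻¹ (B ∣ A) = (I ∣ B⁻¹A)`. -/
theorem exists_map_reducedGenericMatrix (F : Type*) [Field F] {d m : ℕ} (hdm : d ≤ m) :
    ∃ ψ : SmallGenericField F d m →+* GenericField F d m,
      (reducedGenericMatrix F d m).map ψ = (genericBlock F hdm)⁻¹ * genericMatrix F d m := by
  have hinj : Function.Injective ((invMulBlock F hdm).comp
      (rename (Prod.map id Subtype.val) :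
        MvPolynomial (Fin d × {j : Fin m // d ≤ (j : ℕ)}) F →ₐ[F] _)) :=
    (invMulBlock_injective F hdm).comp
      (rename_injective _ (Function.injective_id.prodMap Subtype.val_injective))
  refine ⟨(IsFractionRing.liftAlgHom hinj : SmallGenericField F d m →ₐ[F] _), ?_⟩
  ext i j
  by_cases hj : d ≤ (j : ℕ)
  · simp only [Matrix.map_apply, reducedGenericMatrix, hj, dif_pos]
    refine (IsFractionRing.lift_algebraMap hinj _).trans ?_
    simp [invMulBlock, hj]
  · have h : ((genericBlock F hdm)⁻¹ * genericBlock F hdm) i ⟨j, not_le.1 hj⟩ =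
        (1 : Matrix (Fin d) (Fin d) (GenericField F d m)) i ⟨j, not_le.1 hj⟩ := by
      rw [Matrix.nonsing_inv_mul _ (isUnit_iff_ne_zero.2 (det_genericBlock_ne_zero F hdm))]
    rw [Matrix.one_apply, Matrix.mul_apply] at h
    simp only [Matrix.map_apply, reducedGenericMatrix, hj, dif_neg, not_false_eq_true,
      Matrix.mul_apply]
    refine Eq.trans ?_ h.symm
    simp only [Fin.ext_iff]
    split_ifs <;> simp

/-! ### Embedding the generic field into a purely transcendental extension of the small one. -/

/-- The field extension `F(A)(B)` of `F(A)`. -/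
abbrev BlockExtension (F : Type*) [Field F] (d m : ℕ) : Type _ :=
  FractionRing (MvPolynomial (Fin d × Fin d) (SmallGenericField F d m))

/-- The inclusion `F[B, A] → F(A)(B)`. -/
def toBlockExtension (F : Type*) [Field F] (d m : ℕ) :
    MvPolynomial (Fin d × Fin m) F →+* BlockExtension F d m :=
  (algebraMap _ (BlockExtension F d m)).comp <|
    (MvPolynomial.map (algebraMap _ (SmallGenericField F d m))).comp <|
      (sumAlgEquiv F (Fin d × Fin d) (Fin d × {j : Fin m // d ≤ (j : ℕ)})).toRingHom.comp <|
        (rename fun x => if h : d ≤ (x.2 : ℕ) then Sum.inr (x.1, ⟨x.2, h⟩)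
          else Sum.inl (x.1, ⟨x.2, not_le.1 h⟩) : MvPolynomial (Fin d × Fin m) F →ₐ[F] _).toRingHom

theorem toBlockExtension_injective (F : Type*) [Field F] (d m : ℕ) :
    Function.Injective (toBlockExtension F d m) := by
  refine (IsFractionRing.injective (MvPolynomial (Fin d × Fin d) (SmallGenericField F d m))
    (BlockExtension F d m)).comp <|
    (map_injective _ (IsFractionRing.injective
      (MvPolynomial (Fin d × {j : Fin m // d ≤ (j : ℕ)}) F) (SmallGenericField F d m))).comp <|
      (sumAlgEquiv F _ _).injective.comp <| rename_injective _ ?_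
  rintro ⟨i, j⟩ ⟨i', j'⟩ h
  dsimp only at h
  split_ifs at h <;> simp_all [Fin.ext_iff]

theorem toBlockExtension_X (F : Type*) [Field F] (d m : ℕ) (i : Fin d) (j : Fin m)
    (hj : d ≤ (j : ℕ)) : toBlockExtension F d m (X (i, j)) =
      algebraMap (SmallGenericField F d m) (BlockExtension F d m)
        (reducedGenericMatrix F d m i j) := by
  simp only [toBlockExtension, RingHom.comp_apply, AlgHom.toRingHom_eq_coe,
    RingEquiv.toRingHom_eq_coe, RingHom.coe_coe, rename_X, hj,
    dif_pos, reducedGenericMatrix]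
  refine (congr_arg _ ((congr_arg _ (sumAlgEquiv_X_inr _ _ _ _)).trans (map_C _ _))).trans ?_
  exact (IsScalarTower.algebraMap_apply _
    (MvPolynomial (Fin d × Fin d) (SmallGenericField F d m)) _ _).symm

/-- An embedding of fields under which `(B ∣ A)` becomes `B (I ∣ A) = (B ∣ BA)`. -/
theorem exists_map_genericMatrix (F : Type*) [Field F] {d m : ℕ} (hdm : d ≤ m) :
    ∃ (φ : GenericField F d m →+* BlockExtension F d m)
      (B : Matrix (Fin d) (Fin d) (BlockExtension F d m)), B.det ≠ 0 ∧
      (genericMatrix F d m).map φ = B * (reducedGenericMatrix F d m).map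
        (algebraMap (SmallGenericField F d m) (BlockExtension F d m)) := by
  have hinj : Function.Injective ((toBlockExtension F d m).comp (mulBlock F hdm).toRingHom) :=
    (toBlockExtension_injective F d m).comp (mulBlock_injective F hdm)
  let φ : GenericField F d m →+* BlockExtension F d m := IsFractionRing.lift hinj
  have hφ : ∀ i j, φ (genericMatrix F d m i j) =
      toBlockExtension F d m (mulBlock F hdm (X (i, j))) :=
    fun i j => IsFractionRing.lift_algebraMap hinj _
  refine ⟨φ, (genericBlock F hdm).map φ, ?_, ?_⟩
  · rw [← RingHom.mapMatrix_apply, ← RingHom.map_det]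
    exact (map_ne_zero φ).2 (det_genericBlock_ne_zero F hdm)
  · have hB : ∀ i l, φ (genericBlock F hdm i l) =
        toBlockExtension F d m (X (i, Fin.castLE hdm l)) := by
      intro i l
      have : ¬ d ≤ ((Fin.castLE hdm l : Fin m) : ℕ) := by simp
      rw [genericBlock, Matrix.submatrix_apply, hφ, id, mulBlock, aeval_X, if_neg this]
    ext i j
    rw [Matrix.map_apply, Matrix.mul_apply]
    by_cases hj : d ≤ (j : ℕ)
    · rw [hφ, mulBlock, aeval_X, if_pos hj, map_sum]
      simp only [Matrix.map_apply, hB, map_mul, toBlockExtension_X F d m _ j hj]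
    -- Column `j < d` of `(I ∣ A)` is a unit vector, so the product returns column `j` of `B`, which
    -- `mulBlock` leaves fixed.
    · have h : ∀ l : Fin d, reducedGenericMatrix F d m l j =
          if l = ⟨j, not_le.1 hj⟩ then 1 else 0 := by
        intro l
        simp [reducedGenericMatrix, hj, Fin.ext_iff]
      simp [h, apply_ite, genericBlock]

end

/-! ### The l.s.o.p. property for `(I ∣ A)` and the conclusion. -/

theorem linearIndependent_reducedGenericMatrix (F : Type*) [Field F] {d m : ℕ} (hdm : d ≤ m)
    (σ : Finset (Fin m)) (hσ : σ.card ≤ d) :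
    LinearIndependent (SmallGenericField F d m)
      fun v : σ => fun i => reducedGenericMatrix F d m i v := by
  obtain ⟨ψ, hψ⟩ := exists_map_reducedGenericMatrix F hdm
  have hB : IsUnit (genericBlock F hdm).det :=
    isUnit_iff_ne_zero.2 (det_genericBlock_ne_zero F hdm)
  -- Applying `ψ` and then multiplying by `B` turns a relation among columns of `(I ∣ A)` into one
  -- among generic columns.
  have hM : genericMatrix F d m = genericBlock F hdm * (reducedGenericMatrix F d m).map ψ := by
    rw [hψ, Matrix.mul_nonsing_inv_cancel_left _ _ hB]
  have hli := linearIndependent_genericMatrix F σ hσ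
  rw [Fintype.linearIndependent_iff] at hli ⊢
  intro g hg v
  refine (map_eq_zero ψ).1 (hli (fun w => ψ (g w)) ?_ v)
  ext i
  have h : ∀ l, ∑ w : σ, ψ (g w) * ψ (reducedGenericMatrix F d m l w) = 0 := by
    intro l
    have := congr_arg ψ (congr_fun hg l)
    simpa [map_sum] using this
  rw [hM]
  simp only [Finset.sum_apply, Pi.smul_apply, smul_eq_mul, Matrix.mul_apply, Matrix.map_apply,
    Pi.zero_apply, Finset.mul_sum]
  rw [Finset.sum_comm]
  refine Finset.sum_eq_zero fun l _ => ?_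
  simp only [mul_left_comm (ψ _) (genericBlock F hdm i l), ← Finset.mul_sum, h, mul_zero]

theorem mainTheorem5 (F : Type*) [Field F] (d m : ℕ) (Δ : AbstractSimplicialComplex (Fin m))
    (hΔ : Δ.toPreAbstractSimplicialComplex.IsHomologySphere F d) :
    Δ.toPreAbstractSimplicialComplex.IsLSOP (linearForms (genericMatrix F d m)) ∧
    Δ.toPreAbstractSimplicialComplex.IsLSOP (linearForms (reducedGenericMatrix F d m)) ∧
    (Δ.toPreAbstractSimplicialComplex.IsAnisotropic (linearForms (genericMatrix F d m)) ↔
      Δ.toPreAbstractSimplicialComplex.IsAnisotropic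
        (linearForms (reducedGenericMatrix F d m))) := by
  have hgr := hΔ.isGreatest_card
  have hcard : ∀ σ ∈ Δ.toPreAbstractSimplicialComplex.allFaces, σ.card ≤ d :=
    fun σ hσ => hgr.2 ⟨σ, hσ, rfl⟩
  -- A facet with `d` vertices exists, so the matrix has enough columns for the block `B`.
  have hdm : d ≤ m := by
    obtain ⟨σ, -, hσ⟩ := hgr.1
    rw [← hσ]
    simpa using Finset.card_le_univ σ
  refine ⟨⟨hgr, isHomogeneous_linearForms _, ?_⟩, ⟨hgr, isHomogeneous_linearForms _, ?_⟩, ?_, ?_⟩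
  · exact PreAbstractSimplicialComplex.finite_reduction _ _ fun σ hσ =>
      linearIndependent_genericMatrix F σ (hcard σ hσ)
  · exact PreAbstractSimplicialComplex.finite_reduction _ _ fun σ hσ =>
      linearIndependent_reducedGenericMatrix F hdm σ (hcard σ hσ)
  -- Descend along `𝕜' → 𝕜`, after the row operation `B⁻¹`.
  · intro h
    obtain ⟨ψ, hψ⟩ := exists_map_reducedGenericMatrix F hdm
    refine PreAbstractSimplicialComplex.IsAnisotropic.of_map ψ ?_
    rw [hψ, PreAbstractSimplicialComplex.isAnisotropic_mul_iff]
    · exact h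
    · exact (Matrix.isUnit_nonsing_inv_det _
        (isUnit_iff_ne_zero.2 (det_genericBlock_ne_zero F hdm))).ne_zero
  -- Ascend from `𝕜'` to `𝕜'(B)`, undo the row operation, then descend to `𝕜` along `φ`.
  · intro h
    obtain ⟨φ, B, hB, hφ⟩ := exists_map_genericMatrix F hdm
    refine PreAbstractSimplicialComplex.IsAnisotropic.of_map φ ?_
    rw [hφ, PreAbstractSimplicialComplex.isAnisotropic_mul_iff _ B hB]
    obtain ⟨mo⟩ := nonempty_monomialOrder (Fin d × Fin d)
    exact h.map_fractionRing mo
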